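/- Let $(\Omega,\mathcal G,\mathbb P)$ be an atomless probability space, i.e. one that carries a random variable uniformly distributed on $[0,1]$. Let $\phi\colon[0,1]\to[0,\infty)$ be (weakly) decreasing and bounded with $\int_0^1\phi(t)\,dt=1$, and let $\rho$ be the spectral risk measure with risk spectrum $\phi$, $$\rho(X)=\int_0^1 \mathrm{VaR}_\alpha(X)\,\phi(\alpha)\,d\alpha,\qquad \mathrm{VaR}_\alpha(X)=\inf\{m\in\mathbb R:\ \mathbb P(X+m<0)\le\alpha\}.$$ For every $n>1$ let $a_{1,n}\ge a_{2,n}\ge\dots\ge a_{n,n}\ge 0$ with $\sum_{i=1}^n a_{i,n}=1$, and for $\mathbf x\in\mathbb R^n$ put $$\hat\rho_n(\mathbf x)=-\sum_{i=1}^n a_{i,n}\,x_{i:n},$$ where $x_{i:n}$ is the $i$-th smallest of $x_1,\dots,x_n$. Put $\phi_n(t)=\sum_{i=1}^n n\,a_{i,n}\,\mathbf 1_{\{t\in(\frac{i-1}n,\frac in]\}}$ for $t\in[0,1]$, and assume that $\sup_{n>1}\sup_{t\in[0,1]}\phi_n(t)<\infty$. Then $\rho(X)$ is well defined and finite (the integral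 converges absolutely) for every $X\in L^1(\Omega,\mathcal G,\mathbb P)$, and the following two conditions are equivalent. 1. $(\hat\rho_n)$ is (strongly) consistent for $\rho$ on $L^1$: for every $X\in L^1(\Omega,\mathcal G,\mathbb P)$ and every i.i.d. sequence $X_1,X_2,\dots$ on $(\Omega,\mathcal G,\mathbb P)$ with the distribution of $X$, $\hat\rho_n(X_1,\dots,X_n)\to\rho(X)$ $\mathbb P$-almost surely as $n\to\infty$. 2. For every $t\in(0,1)$, $\int_0^t\phi_n(s)\,ds\to\int_0^t\phi(s)\,ds$ as $n\to\infty$. -/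

import Mathlib

open Set Filter Topology MeasureTheory ProbabilityTheory

/-- The ordered version `s(x) = (x_{1:n}, …, x_{n:n})` of `x ∈ ℝⁿ`, in increasing order; with indices
starting at `0`, the `i`-th coordinate is the order statistic `x_{i+1:n}`. -/
noncomputable def orderStat {n : ℕ} (x : Fin n → ℝ) : Fin n → ℝ :=
  x ∘ Tuple.sort x

/-- The `L`-estimator `x ↦ -∑ a_i x_{i:n}` with weights `a`. -/
noncomputable def lEstimator {n : ℕ} (a : Fin n → ℝ) (x : Fin n → ℝ) : ℝ :=
  -∑ i, a i * orderStat x i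

/-- The step function `t ↦ ∑_{i=1}^n n a_i 1{t ∈ ((i-1)/n, i/n]}` of the weights `a`. -/
noncomputable def stepSpectrum {n : ℕ} (a : Fin n → ℝ) (t : ℝ) : ℝ :=
  ∑ i : Fin n, (Ioc ((i : ℝ) / n) (((i : ℝ) + 1) / n)).indicator (fun _ => (n : ℝ) * a i) t

/-- The value at risk `VaR_α(X) = inf {m ∈ ℝ | P(X + m < 0) ≤ α}` (used for `α ∈ (0,1)`). -/
noncomputable def valueAtRisk {Ω : Type*} [MeasurableSpace Ω] (P : Measure Ω) (α : ℝ)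
    (X : Ω → ℝ) : ℝ :=
  sInf {m : ℝ | P.real {ω | X ω + m < 0} ≤ α}

/-- A risk spectrum: a nonnegative, (weakly) decreasing, bounded function on `[0,1]` with
integral `1`. Only the values of `φ` on `[0,1]` matter. -/
structure IsRiskSpectrum (φ : ℝ → ℝ) : Prop where
  nonneg : ∀ t ∈ Icc (0 : ℝ) 1, 0 ≤ φ t
  antitoneOn : AntitoneOn φ (Icc 0 1)
  bounded : ∃ C : ℝ, ∀ t ∈ Icc (0 : ℝ) 1, φ t ≤ C
  integral_eq_one : ∫ t in (0 : ℝ)..1, φ t = 1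

/-- The spectral risk measure `ρ(X) = ∫₀¹ VaR_α(X) φ(α) dα` with spectrum `φ`. -/
noncomputable def spectralRiskMeasure {Ω : Type*} [MeasurableSpace Ω] (P : Measure Ω)
    (φ : ℝ → ℝ) (X : Ω → ℝ) : ℝ :=
  ∫ α in (0 : ℝ)..1, valueAtRisk P α X * φ α

/-- `S₀, S₁, …` is an i.i.d. sample from the distribution of `X`. -/
def IsIIDSample {Ω : Type*} [MeasurableSpace Ω] (P : Measure Ω) (X : Ω → ℝ)
    (S : ℕ → Ω → ℝ) : Prop :=
  iIndepFun S P ∧ ∀ i, IdentDistrib (S i) X P P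

/-- (Strong) consistency on `𝒳` of the estimators `ρhat n : ℝⁿ → ℝ` for `ρ : 𝒳 → ℝ ∪ {+∞}`: for
every `X ∈ 𝒳` with `ρ(X) < +∞` and every i.i.d. sample from the distribution of `X`, the estimators
evaluated at the first `n` sample points converge almost surely to `ρ(X)`. -/
def IsConsistent {Ω : Type*} [MeasurableSpace Ω] (P : Measure Ω) (𝒳 : Set (Ω → ℝ))
    (ρhat : (n : ℕ) → (Fin n → ℝ) → ℝ) (ρ : (Ω → ℝ) → WithTop ℝ) : Prop :=
  ∀ X ∈ 𝒳, ∀ r : ℝ, ρ X = (r : WithTop ℝ) → ∀ S : ℕ → Ω → ℝ, IsIIDSample P X S →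
    ∀ᵐ ω ∂P, Tendsto (fun n : ℕ => ρhat n (fun i : Fin n => S i ω)) atTop (𝓝 r)

/-! ### Value at risk as a generalized inverse, and its law under the uniform distribution -/

section ValueAtRisk

/-! The estimator is itself a spectral risk: it equals `∫ VaR_t · φ_n(t) dt` for the empirical
distribution of the sample (`integral_valueAtRisk_uniformOn_mul_stepSpectrum`). The strong law,
applied to `1{x + q < 0}` for rational `q` and to `|x|`, gives almost sure convergence of the
empirical distribution functions and first absolute moments, hence `L¹(0,1)` convergence of the
empirical values at risk. Since the `φ_n` are uniformly bounded, the estimator minus `∫ VaR_t(X)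
φ_n(t) dt` tends to `0` almost surely, whether or not the `φ_n` converge
(`IsIIDSample.ae_tendsto_lEstimator_sub`). What remains is deterministic: when does `∫ VaR_t(X)
φ_n(t) dt` tend to `∫ VaR_t(X) φ(t) dt`?

Necessity: with `U` uniform, `X = -1{U ≤ t}` has value at risk `1{α < t}`, so these integrals are
exactly the primitives at `t`. Sufficiency: for decreasing functions, convergence of primitives
forces convergence at continuity points of the limit, hence almost everywhere, and dominated
convergence applies. -/

lemma antitone_setOf_add_neg {Ω : Type*} (X : Ω → ℝ) : Antitone fun m : ℝ => {ω | X ω + m < 0} := by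
  intro m m' h ω hω
  simp only [mem_ofPred_eq] at hω ⊢
  linarith

variable {Ω : Type*} [MeasurableSpace Ω] {P : Measure Ω} [IsProbabilityMeasure P] {X : Ω → ℝ}

/-- Ensures that the infimum defining the value at risk is over a nonempty set. -/
lemma exists_measureReal_add_neg_le (hX : AEMeasurable X P) {α : ℝ} (hα : 0 < α) :
    ∃ m : ℝ, P.real {ω | X ω + m < 0} ≤ α := by
  have h := tendsto_measure_iInter_atTop (μ := P) (s := fun k : ℕ => {ω | X ω + k < 0})
    (fun k => nullMeasurableSet_lt (hX.add_const _) aemeasurable_const)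
    (fun k l hkl => antitone_setOf_add_neg X (Nat.cast_le.2 hkl)) ⟨0, measure_ne_top _ _⟩
  have h0 : ⋂ k : ℕ, {ω | X ω + k < 0} = ∅ := by
    ext ω
    obtain ⟨k, hk⟩ := exists_nat_ge (-X ω)
    simp only [mem_iInter, mem_ofPred_eq, mem_empty_iff_false, iff_false, not_forall]
    exact ⟨k, by linarith⟩
  rw [h0, measure_empty] at h
  have h' := (ENNReal.tendsto_toReal ENNReal.zero_ne_top).comp h
  obtain ⟨k, hk⟩ := (h'.eventually_lt_const (by simpa using hα)).exists
  exact ⟨k, hk.le⟩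

/-- Ensures, with monotonicity, that the same set is bounded below. -/
lemma exists_lt_measureReal_add_neg (P : Measure Ω) [IsProbabilityMeasure P] (X : Ω → ℝ) {α : ℝ}
    (hα : α < 1) : ∃ m : ℝ, α < P.real {ω | X ω + m < 0} := by
  have h := tendsto_measure_iUnion_atTop (μ := P) (s := fun k : ℕ => {ω | X ω + -(k : ℝ) < 0})
    (fun k l hkl => antitone_setOf_add_neg X (neg_le_neg (Nat.cast_le.2 hkl)))
  have h0 : ⋃ k : ℕ, {ω | X ω + -(k : ℝ) < 0} = univ := by
    ext ω
    obtain ⟨k, hk⟩ := exists_nat_gt (X ω)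
    simp only [mem_iUnion, mem_ofPred_eq, mem_univ, iff_true]
    exact ⟨k, by linarith⟩
  rw [h0, measure_univ] at h
  have h' := (ENNReal.tendsto_toReal ENNReal.one_ne_top).comp h
  obtain ⟨k, hk⟩ := (h'.eventually_const_lt (by simpa using hα)).exists
  exact ⟨_, hk⟩

/-- The value at risk is a generalized inverse of `m ↦ P(X + m < 0)`. -/
lemma valueAtRisk_le_iff (hX : AEMeasurable X P) {α : ℝ} (hα : α ∈ Ioo (0 : ℝ) 1) {m : ℝ} :
    valueAtRisk P α X ≤ m ↔ P.real {ω | X ω + m < 0} ≤ α := by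
  have hanti : Antitone fun m : ℝ => P.real {ω | X ω + m < 0} := fun m m' h =>
    measureReal_mono (antitone_setOf_add_neg X h)
  have hbdd : BddBelow {m : ℝ | P.real {ω | X ω + m < 0} ≤ α} := by
    obtain ⟨l, hl⟩ := exists_lt_measureReal_add_neg P X hα.2
    refine ⟨l, fun m hm => ?_⟩
    by_contra! hlt
    exact (hl.trans_le (hanti hlt.le)).not_ge hm
  refine ⟨fun h => (hanti h).trans ?_, fun h => csInf_le hbdd h⟩
  set v := valueAtRisk P α X with hv
  have hlt : ∀ ε > 0, P.real {ω | X ω + (v + ε) < 0} ≤ α := by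
    intro ε hε
    obtain ⟨m', hm', hlt⟩ := exists_lt_of_csInf_lt
      (s := {m : ℝ | P.real {ω | X ω + m < 0} ≤ α}) (exists_measureReal_add_neg_le hX hα.1)
      (show sInf _ < v + ε by rw [hv, valueAtRisk]; linarith)
    exact (hanti hlt.le).trans hm'
  -- The infimum is attained: the events at `v + 1/(k+1)` increase to the event at `v`, so
  -- continuity from below preserves the bound `α`.
  have ht := tendsto_measure_iUnion_atTop (μ := P)
    (s := fun k : ℕ => {ω | X ω + (v + 1 / ((k : ℝ) + 1)) < 0}) (fun k l hkl =>
      antitone_setOf_add_neg X (by gcongr))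
  have hU : ⋃ k : ℕ, {ω | X ω + (v + 1 / ((k : ℝ) + 1)) < 0} = {ω | X ω + v < 0} := by
    ext ω
    simp only [mem_iUnion, mem_ofPred_eq]
    refine ⟨fun ⟨k, hk⟩ => ?_, fun h => ?_⟩
    · have : (0 : ℝ) < 1 / ((k : ℝ) + 1) := by positivity
      linarith
    · obtain ⟨k, hk⟩ := exists_nat_one_div_lt (show 0 < -(X ω + v) by linarith)
      exact ⟨k, by linarith⟩
  rw [hU] at ht
  exact le_of_tendsto ((ENNReal.tendsto_toReal (measure_ne_top _ _)).comp ht)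
    (Eventually.of_forall fun k => hlt _ (by positivity))

lemma antitoneOn_valueAtRisk (hX : AEMeasurable X P) :
    AntitoneOn (fun α => valueAtRisk P α X) (Ioo 0 1) := fun _ hα _ hβ h =>
  (valueAtRisk_le_iff hX hβ).2 (((valueAtRisk_le_iff hX hα).1 le_rfl).trans h)

/-- Under the uniform distribution on `(0, 1)`, the value at risk of `X` has the law of `-X`. -/
lemma identDistrib_valueAtRisk (hX : AEMeasurable X P) :
    IdentDistrib (fun α => valueAtRisk P α X) (fun ω => -X ω)
      (volume.restrict (Ioo (0 : ℝ) 1)) P := by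
  have hV := aemeasurable_restrict_of_antitoneOn (μ := volume) measurableSet_Ioo
    (antitoneOn_valueAtRisk hX)
  have hneg : AEMeasurable (fun ω => -X ω) P := hX.neg
  refine ⟨hV, hneg, ?_⟩
  have : IsProbabilityMeasure (P.map fun ω => -X ω) := Measure.isProbabilityMeasure_map hneg
  have : IsFiniteMeasure ((volume.restrict (Ioo (0 : ℝ) 1)).map fun α => valueAtRisk P α X) :=
    Measure.isFiniteMeasure_map _ _
  refine Measure.ext_of_Iic _ _ fun m => ?_
  set p := P.real {ω | X ω + m < 0} with hp
  rw [Measure.map_apply_of_aemeasurable hV measurableSet_Iic,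
    Measure.map_apply_of_aemeasurable hneg measurableSet_Iic,
    Measure.restrict_apply' measurableSet_Ioo]
  have h1 : (fun α => valueAtRisk P α X) ⁻¹' Iic m ∩ Ioo 0 1 = Ici p ∩ Ioo 0 1 := by
    ext α
    simp only [mem_inter_iff, mem_preimage, mem_Iic, mem_Ici]
    exact and_congr_left fun hα => valueAtRisk_le_iff hX hα
  -- Since `p` may be `0` or `1`, the set is squeezed between `Ioo p 1` and `Icc p 1`, both of
  -- length `1 - p`.
  have h2 : volume (Ici p ∩ Ioo 0 1) = ENNReal.ofReal (1 - p) := by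
    have hp0 : 0 ≤ p := measureReal_nonneg
    refine le_antisymm ?_ ?_
    · refine (measure_mono (t := Icc p 1) fun x hx => ⟨hx.1, hx.2.2.le⟩).trans ?_
      simp
    · refine le_trans ?_ (measure_mono (s := Ioo p 1)
        fun x hx => ⟨hx.1.le, hp0.trans_lt hx.1, hx.2⟩)
      simp
  have h3 : (fun ω => -X ω) ⁻¹' Iic m = {ω | X ω + m < 0}ᶜ := by
    ext ω
    simp only [mem_preimage, mem_Iic, mem_compl_iff, mem_ofPred_eq, not_lt]
    constructor <;> intro h <;> linarith
  rw [h1, h2, h3, hp, ← probReal_compl_eq_one_sub₀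
    (nullMeasurableSet_lt (hX.add_const _) aemeasurable_const), ofReal_measureReal]

lemma integrableOn_valueAtRisk (hX : Integrable X P) :
    IntegrableOn (fun α => valueAtRisk P α X) (Ioo 0 1) :=
  (identDistrib_valueAtRisk hX.aemeasurable).integrable_iff.2 hX.neg

lemma integral_abs_valueAtRisk (hX : AEMeasurable X P) :
    ∫ α in Ioo (0 : ℝ) 1, |valueAtRisk P α X| = ∫ ω, |X ω| ∂P := by
  have h := (identDistrib_valueAtRisk hX).norm.integral_eq
  simpa [Real.norm_eq_abs] using h

end ValueAtRisk

/-! ### Deterministic convergence of quantiles and of monotone functions -/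

section Convergence

/-- The inverse property turns bounds on quantiles into bounds on distribution functions at a
separating rational `q`. The lower bound needs no continuity; the upper one uses left continuity at
`t` to find `s < t` whose quantile is still below the bound, leaving room between `s` and `t`. -/
lemma tendsto_valueAtRisk {Ω : Type*} [MeasurableSpace Ω] {P : Measure Ω} [IsProbabilityMeasure P]
    {X : Ω → ℝ} (hX : AEMeasurable X P) {ι : ℕ → Type*} [∀ n, MeasurableSpace (ι n)]
    {Q : (n : ℕ) → Measure (ι n)} [∀ n, IsProbabilityMeasure (Q n)] {Y : (n : ℕ) → ι n → ℝ}
    (hY : ∀ n, AEMeasurable (Y n) (Q n))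
    (hQ : ∀ q : ℚ, Tendsto (fun n => (Q n).real {ω | Y n ω + q < 0}) atTop
      (𝓝 (P.real {ω | X ω + q < 0})))
    {t : ℝ} (ht : t ∈ Ioo (0 : ℝ) 1) (hc : ContinuousAt (fun α => valueAtRisk P α X) t) :
    Tendsto (fun n => valueAtRisk (Q n) t (Y n)) atTop (𝓝 (valueAtRisk P t X)) := by
  refine tendsto_order.2 ⟨fun b hb => ?_, fun b hb => ?_⟩
  · obtain ⟨q, hbq, hq⟩ := exists_rat_btwn hb
    have h := lt_of_not_ge (mt (valueAtRisk_le_iff hX ht).2 hq.not_ge)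
    filter_upwards [(hQ q).eventually_const_lt h] with n hn
    exact hbq.trans (lt_of_not_ge (mt (valueAtRisk_le_iff (hY n) ht).1 hn.not_ge))
  · obtain ⟨s, hsb, hs⟩ := (((hc.eventually_lt_const hb).filter_mono (nhdsWithin_le_nhds (s := Iio t))).and
      (eventually_mem_set.2 (Ioo_mem_nhdsLT ht.1))).exists
    obtain ⟨q, hq, hqb⟩ := exists_rat_btwn hsb
    have h := (valueAtRisk_le_iff hX ⟨hs.1, hs.2.trans ht.2⟩).1 hq.le
    filter_upwards [(hQ q).eventually_lt_const (h.trans_lt hs.2)] with n hn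
    exact ((valueAtRisk_le_iff (hY n) ht).2 hn.le).trans_lt hqb

/-- An antitone function on `(0, 1)` is continuous almost everywhere. -/
lemma AntitoneOn.ae_continuousAt_Ioo {g : ℝ → ℝ} (hg : AntitoneOn g (Ioo 0 1)) :
    ∀ᵐ t ∂volume.restrict (Ioo (0 : ℝ) 1), t ∈ Ioo (0 : ℝ) 1 ∧ ContinuousAt g t := by
  have h := hg.countable_not_continuousWithinAt.ae_notMem (volume.restrict (Ioo (0 : ℝ) 1))
  filter_upwards [h, ae_restrict_mem measurableSet_Ioo] with t ht ht'
  refine ⟨ht', ?_⟩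
  by_contra hn
  exact ht ⟨ht', fun hc => hn (hc.continuousAt (Ioo_mem_nhds ht'.1 ht'.2))⟩

/-- A.e. convergence together with convergence of the `L¹` norms implies convergence in `L¹`. -/
lemma tendsto_integral_abs_sub_of_tendsto_integral_abs {α : Type*} [MeasurableSpace α]
    {μ : Measure α} {f : ℕ → α → ℝ} {g : α → ℝ} (hf : ∀ n, Integrable (f n) μ)
    (hg : Integrable g μ) (hae : ∀ᵐ x ∂μ, Tendsto (fun n => f n x) atTop (𝓝 (g x)))
    (hnorm : Tendsto (fun n => ∫ x, |f n x| ∂μ) atTop (𝓝 (∫ x, |g x| ∂μ))) :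
    Tendsto (fun n => ∫ x, |f n x - g x| ∂μ) atTop (𝓝 0) := by
  -- Subtracting `|f n|` makes the integrand dominated by `|g|`, by the reverse triangle inequality;
  -- `hnorm` then restores the subtracted term.
  have h : Tendsto (fun n => ∫ x, (|f n x - g x| - |f n x|) ∂μ) atTop
      (𝓝 (∫ x, -|g x| ∂μ)) := by
    refine tendsto_integral_of_dominated_convergence (fun x => |g x|)
      (fun n => (((hf n).sub hg).abs.sub (hf n).abs).aestronglyMeasurable) hg.abs
      (fun n => Eventually.of_forall fun x => ?_) ?_
    · have h := abs_abs_sub_abs_le_abs_sub (f n x - g x) (f n x)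
      rwa [sub_sub_cancel_left, abs_neg] at h
    · filter_upwards [hae] with x hx
      simpa using (hx.sub_const (g x)).abs.sub hx.abs
  have h2 := h.add hnorm
  rw [integral_neg, neg_add_cancel] at h2
  refine h2.congr fun n => ?_
  have hs : Integrable (fun x => |f n x - g x|) μ := ((hf n).sub hg).abs
  rw [integral_sub hs (hf n).abs, sub_add_cancel]

/-- Convergence of the distribution functions and of the first absolute moments implies
convergence of the values at risk in `L¹(0, 1)`. -/
lemma tendsto_integral_abs_valueAtRisk_sub {Ω : Type*} [MeasurableSpace Ω] {P : Measure Ω}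
    [IsProbabilityMeasure P] {X : Ω → ℝ} (hX : Integrable X P)
    {ι : ℕ → Type*} [∀ n, MeasurableSpace (ι n)]
    {Q : (n : ℕ) → Measure (ι n)} [∀ n, IsProbabilityMeasure (Q n)] {Y : (n : ℕ) → ι n → ℝ}
    (hY : ∀ n, Integrable (Y n) (Q n))
    (hQ : ∀ q : ℚ, Tendsto (fun n => (Q n).real {ω | Y n ω + q < 0}) atTop
      (𝓝 (P.real {ω | X ω + q < 0})))
    (hnorm : Tendsto (fun n => ∫ ω, |Y n ω| ∂Q n) atTop (𝓝 (∫ ω, |X ω| ∂P))) :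
    Tendsto (fun n => ∫ t in Ioo (0 : ℝ) 1, |valueAtRisk (Q n) t (Y n) - valueAtRisk P t X|)
      atTop (𝓝 0) := by
  refine tendsto_integral_abs_sub_of_tendsto_integral_abs
    (fun n => integrableOn_valueAtRisk (hY n)) (integrableOn_valueAtRisk hX) ?_ ?_
  · filter_upwards [(antitoneOn_valueAtRisk hX.aemeasurable).ae_continuousAt_Ioo] with t ht
    exact tendsto_valueAtRisk hX.aemeasurable (fun n => (hY n).aemeasurable) hQ ht.1 ht.2
  · rw [integral_abs_valueAtRisk hX.aemeasurable]
    exact hnorm.congr fun n => (integral_abs_valueAtRisk (hY n).aemeasurable).symm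

/-- If the primitives of antitone functions converge, then so do the functions, at the continuity
points of the limit. -/
lemma tendsto_of_tendsto_integral_of_antitoneOn {f : ℕ → ℝ → ℝ} {g : ℝ → ℝ}
    (hf : ∀ n, AntitoneOn (f n) (Ioo 0 1)) (hg : AntitoneOn g (Ioo 0 1))
    (hfi : ∀ n, IntervalIntegrable (f n) volume 0 1) (hgi : IntervalIntegrable g volume 0 1)
    (h : ∀ t ∈ Ioo (0 : ℝ) 1,
      Tendsto (fun n => ∫ s in (0 : ℝ)..t, f n s) atTop (𝓝 (∫ s in (0 : ℝ)..t, g s)))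
    {t : ℝ} (ht : t ∈ Ioo (0 : ℝ) 1) (hc : ContinuousAt g t) :
    Tendsto (fun n => f n t) atTop (𝓝 (g t)) := by
  have hsub : ∀ k : ℝ → ℝ, IntervalIntegrable k volume 0 1 → ∀ u v, 0 < u → u < v → v < 1 →
      IntervalIntegrable k volume u v := fun k hk u v hu huv hv =>
    hk.mono_set (by rw [uIcc_of_le huv.le, uIcc_of_le zero_le_one]; exact Icc_subset_Icc hu.le hv.le)
  have hbound : ∀ k : ℝ → ℝ, AntitoneOn k (Ioo 0 1) → IntervalIntegrable k volume 0 1 →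
      ∀ u v, 0 < u → u < v → v < 1 →
      (v - u) * k v ≤ ∫ s in u..v, k s ∧ ∫ s in u..v, k s ≤ (v - u) * k u := by
    intro k hk hki u v hu huv hv
    have hi := hsub k hki u v hu huv hv
    constructor
    · have := intervalIntegral.integral_mono_on huv.le (intervalIntegrable_const (c := k v)) hi
        fun x hx => hk ⟨hu.trans_le hx.1, hx.2.trans_lt hv⟩ ⟨hu.trans huv, hv⟩ hx.2
      simpa using this
    · have := intervalIntegral.integral_mono_on huv.le hi (intervalIntegrable_const (c := k u))
        fun x hx => hk ⟨hu, huv.trans hv⟩ ⟨hu.trans_le hx.1, hx.2.trans_lt hv⟩ hx.1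
      simpa using this
  have hlim : ∀ u v, 0 < u → u < v → v < 1 →
      Tendsto (fun n => ∫ s in u..v, f n s) atTop (𝓝 (∫ s in u..v, g s)) := by
    intro u v hu huv hv
    have hpre : ∀ k : ℝ → ℝ, IntervalIntegrable k volume 0 1 →
        (∫ s in (0 : ℝ)..v, k s) - ∫ s in (0 : ℝ)..u, k s = ∫ s in u..v, k s := fun k hk =>
      intervalIntegral.integral_interval_sub_left
        (hk.mono_set (by
          rw [uIcc_of_le (hu.trans huv).le, uIcc_of_le zero_le_one]
          exact Icc_subset_Icc le_rfl hv.le))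
        (hk.mono_set (by
          rw [uIcc_of_le hu.le, uIcc_of_le zero_le_one]
          exact Icc_subset_Icc le_rfl (huv.trans hv).le))
    have := (h v ⟨hu.trans huv, hv⟩).sub (h u ⟨hu, huv.trans hv⟩)
    rw [hpre g hgi] at this
    exact this.congr fun n => hpre _ (hfi n)
  refine tendsto_order.2 ⟨fun b hb => ?_, fun b hb => ?_⟩
  -- The mean of `g` over `[t, v]` is at least `g v > b`, so eventually the mean of `f n` exceeds
  -- `b`; by monotonicity that mean is at most `f n t`. The upper bound is symmetric, to the left of
  -- `t`.
  · obtain ⟨v, hvb, hv⟩ := (((hc.eventually_const_lt hb).filter_mono (nhdsWithin_le_nhds (s := Ioi t))).and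
      (eventually_mem_set.2 (Ioo_mem_nhdsGT ht.2))).exists
    have hpos : 0 < v - t := sub_pos.2 hv.1
    have hlt : (v - t) * b < ∫ s in t..v, g s :=
      (mul_lt_mul_of_pos_left hvb hpos).trans_le (hbound g hg hgi t v ht.1 hv.1 hv.2).1
    filter_upwards [(hlim t v ht.1 hv.1 hv.2).eventually_const_lt hlt] with n hn
    exact lt_of_mul_lt_mul_left
      (hn.trans_le (hbound _ (hf n) (hfi n) t v ht.1 hv.1 hv.2).2) hpos.le
  · obtain ⟨u, hub, hu⟩ := (((hc.eventually_lt_const hb).filter_mono (nhdsWithin_le_nhds (s := Iio t))).and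
      (eventually_mem_set.2 (Ioo_mem_nhdsLT ht.1))).exists
    have hpos : 0 < t - u := sub_pos.2 hu.2
    have hlt : ∫ s in u..t, g s < (t - u) * b :=
      (hbound g hg hgi u t hu.1 hu.2 ht.2).2.trans_lt (mul_lt_mul_of_pos_left hub hpos)
    filter_upwards [(hlim u t hu.1 hu.2 ht.2).eventually_lt_const hlt] with n hn
    exact lt_of_mul_lt_mul_left
      ((hbound _ (hf n) (hfi n) u t hu.1 hu.2 ht.2).1.trans_lt hn) hpos.le

end Convergence

/-! ### Empirical distributions and step spectra -/

section Empirical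

variable {n : ℕ}

instance isProbabilityMeasure_uniformOn_univ_fin [NeZero n] :
    IsProbabilityMeasure (uniformOn (univ : Set (Fin n))) :=
  isProbabilityMeasure_uniformOn finite_univ univ_nonempty

lemma uniformOn_univ_fin_real (s : Set (Fin n)) [DecidablePred (· ∈ s)] :
    (uniformOn (univ : Set (Fin n))).real s = (∑ i, if i ∈ s then (1 : ℝ) else 0) / n := by
  have hs : s = ↑(Finset.univ.filter (· ∈ s)) := by ext; simp
  have hc : Measure.count s = ((Finset.univ.filter (· ∈ s)).card : ENNReal) := by
    conv_lhs => rw [hs]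
    exact Measure.count_apply_finset _
  rw [measureReal_def, uniformOn_univ, hc]
  simp [Finset.sum_boole]

lemma integrable_uniformOn_univ_fin [NeZero n] (x : Fin n → ℝ) :
    Integrable x (uniformOn univ) := Integrable.of_finite

lemma integral_uniformOn_univ_fin [NeZero n] (x : Fin n → ℝ) :
    ∫ i, x i ∂(uniformOn univ) = (∑ i, x i) / n := by
  rw [integral_fintype (integrable_uniformOn_univ_fin x), Finset.sum_div]
  refine Finset.sum_congr rfl fun i _ => ?_
  classical
  rw [uniformOn_univ_fin_real]
  simp
  ring

/-- On this cell, the value at risk is at most `m` exactly when at most `i` sample points lie below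
`-m`, that is, when the order statistic of index `i` is at least `-m`. The right endpoint must be
excluded: there the next order statistic takes over. -/
lemma valueAtRisk_uniformOn [NeZero n] (x : Fin n → ℝ) (i : Fin n) {t : ℝ}
    (ht : t ∈ Ioo ((i : ℝ) / n) (((i : ℝ) + 1) / n)) :
    valueAtRisk (uniformOn (univ : Set (Fin n))) t x = -orderStat x i := by
  have hn : (0 : ℝ) < n := Nat.cast_pos.2 (NeZero.pos n)
  have hi : ((i : ℝ) + 1) ≤ n := by exact_mod_cast i.2
  have ht' : t ∈ Ioo (0 : ℝ) 1 :=
    ⟨lt_of_le_of_lt (by positivity) ht.1, ht.2.trans_le (div_le_one_of_le₀ hi hn.le)⟩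
  refine eq_of_forall_ge_iff fun m => ?_
  rw [valueAtRisk_le_iff (integrable_uniformOn_univ_fin x).aemeasurable ht']
  have hcard : (uniformOn (univ : Set (Fin n))).real {j | x j + m < 0} =
      (Finset.univ.filter fun j => orderStat x j < -m).card / n := by
    classical
    rw [uniformOn_univ_fin_real, Finset.card_filter, Nat.cast_sum,
      ← Equiv.sum_comp (Tuple.sort x)]
    congr 1
    refine Finset.sum_congr rfl fun j _ => ?_
    simp [orderStat, lt_neg_iff_add_neg]
  have hsort := Tuple.lt_card_lt_iff_apply_lt_of_monotone (j := i) (a := -m)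
    (Tuple.monotone_sort x)
  rw [hcard, ← not_iff_not, not_le, not_le, lt_neg]
  refine Iff.trans ?_ hsort
  change _ ↔ (i : ℕ) < (Finset.univ.filter fun j => orderStat x j < -m).card
  set c := (Finset.univ.filter fun j => orderStat x j < -m).card
  constructor
  · intro h
    have : (i : ℝ) / n < c / n := ht.1.trans h
    exact_mod_cast (div_lt_div_iff_of_pos_right hn).1 this
  · intro h
    refine ht.2.trans_le ((div_le_div_iff_of_pos_right hn).2 ?_)
    exact_mod_cast h

lemma measurable_stepSpectrum (a : Fin n → ℝ) : Measurable (stepSpectrum a) :=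
  Finset.measurable_fun_sum _ fun _ _ => measurable_const.indicator measurableSet_Ioc

lemma stepSpectrum_nonneg {a : Fin n → ℝ} (ha : ∀ i, 0 ≤ a i) (t : ℝ) : 0 ≤ stepSpectrum a t :=
  Finset.sum_nonneg fun i _ => indicator_nonneg (fun _ _ => mul_nonneg n.cast_nonneg (ha i)) _

lemma stepSpectrum_eq [NeZero n] (a : Fin n → ℝ) (i : Fin n) {t : ℝ}
    (ht : t ∈ Ioc ((i : ℝ) / n) (((i : ℝ) + 1) / n)) : stepSpectrum a t = n * a i := by
  have hn : (0 : ℝ) < n := Nat.cast_pos.2 (NeZero.pos n)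
  rw [stepSpectrum, Finset.sum_eq_single i, indicator_of_mem ht]
  · intro j _ hj
    refine indicator_of_notMem (fun h => hj (Fin.ext ?_)) _
    have h1 : (i : ℝ) < j + 1 := (div_lt_div_iff_of_pos_right hn).1 (ht.1.trans_le h.2)
    have h2 : (j : ℝ) < i + 1 := (div_lt_div_iff_of_pos_right hn).1 (h.1.trans_le ht.2)
    norm_cast at h1 h2
    omega
  · simp

lemma exists_mem_Ioc_div [NeZero n] {t : ℝ} (ht : t ∈ Ioc (0 : ℝ) 1) :
    ∃ i : Fin n, t ∈ Ioc ((i : ℝ) / n) (((i : ℝ) + 1) / n) := by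
  have hn : (0 : ℝ) < n := Nat.cast_pos.2 (NeZero.pos n)
  -- The index of the cell containing `t` is `⌈t * n⌉₊ - 1`.
  have hpos : 0 < ⌈t * n⌉₊ := Nat.ceil_pos.2 (mul_pos ht.1 hn)
  have hle : ⌈t * n⌉₊ ≤ n := Nat.ceil_le.2 (mul_le_of_le_one_left hn.le ht.2)
  obtain ⟨k, hk⟩ := Nat.exists_eq_succ_of_ne_zero hpos.ne'
  refine ⟨⟨k, by omega⟩, ?_, ?_⟩
  · rw [div_lt_iff₀ hn]
    exact Nat.lt_ceil.1 (by simp only [hk]; omega)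
  · rw [le_div_iff₀ hn]
    refine (Nat.le_ceil _).trans ?_
    rw [hk]
    simp

lemma antitoneOn_stepSpectrum [NeZero n] {a : Fin n → ℝ} (ha : Antitone a) :
    AntitoneOn (stepSpectrum a) (Ioc 0 1) := by
  intro s hs t ht hst
  have hn : (0 : ℝ) < n := Nat.cast_pos.2 (NeZero.pos n)
  obtain ⟨i, hi⟩ := exists_mem_Ioc_div (n := n) hs
  obtain ⟨j, hj⟩ := exists_mem_Ioc_div (n := n) ht
  rw [stepSpectrum_eq a i hi, stepSpectrum_eq a j hj]
  refine mul_le_mul_of_nonneg_left (ha ?_) hn.le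
  have h : (i : ℝ) < j + 1 :=
    (div_lt_div_iff_of_pos_right hn).1 (hi.1.trans_le (hst.trans hj.2))
  norm_cast at h
  exact Fin.le_def.2 (by omega)

/-- An `L`-estimator is the spectral risk measure of the empirical distribution with the step
function of the weights as spectrum. -/
lemma integral_valueAtRisk_uniformOn_mul_stepSpectrum [NeZero n] (a x : Fin n → ℝ) :
    ∫ t in Ioo (0 : ℝ) 1, valueAtRisk (uniformOn (univ : Set (Fin n))) t x * stepSpectrum a t =
      lEstimator a x := by
  have hn : (0 : ℝ) < n := Nat.cast_pos.2 (NeZero.pos n)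
  set V := fun t => valueAtRisk (uniformOn (univ : Set (Fin n))) t x
  have hV : IntegrableOn V (Ioo 0 1) := integrableOn_valueAtRisk (integrable_uniformOn_univ_fin x)
  have hsub : ∀ i : Fin n, Ioo ((i : ℝ) / n) (((i : ℝ) + 1) / n) ⊆ Ioo (0 : ℝ) 1 := fun i t ht =>
    have hi : ((i : ℝ) + 1) ≤ n := by exact_mod_cast i.2
    ⟨lt_of_le_of_lt (by positivity) ht.1, ht.2.trans_le (div_le_one_of_le₀ hi hn.le)⟩
  have hterm : ∀ i : Fin n, ∀ t, V t * (Ioc ((i : ℝ) / n) (((i : ℝ) + 1) / n)).indicator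
      (fun _ => (n : ℝ) * a i) t =
      (Ioc ((i : ℝ) / n) (((i : ℝ) + 1) / n)).indicator (fun t => V t * (n * a i)) t := by
    intro i t
    by_cases h : t ∈ Ioc ((i : ℝ) / n) (((i : ℝ) + 1) / n) <;> simp [h]
  have h1 : ∀ i : Fin n, ∫ t in Ioo (0 : ℝ) 1,
      (Ioc ((i : ℝ) / n) (((i : ℝ) + 1) / n)).indicator (fun t => V t * (n * a i)) t =
      -(a i * orderStat x i) := by
    intro i
    rw [setIntegral_indicator measurableSet_Ioc]
    have hset : (Ioo (0 : ℝ) 1 ∩ Ioc ((i : ℝ) / n) (((i : ℝ) + 1) / n) : Set ℝ) =ᵐ[volume]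
        Ioo ((i : ℝ) / n) (((i : ℝ) + 1) / n) := by
      have := (ae_eq_refl (Ioo (0 : ℝ) 1)).inter
        (Ioo_ae_eq_Ioc (μ := volume) (a := (i : ℝ) / n) (b := ((i : ℝ) + 1) / n))
      rw [inter_eq_self_of_subset_right (hsub i)] at this
      exact this.symm
    rw [setIntegral_congr_set hset, setIntegral_congr_fun (g := fun _ => -orderStat x i * (n * a i))
      measurableSet_Ioo fun t ht => by
        change valueAtRisk _ t x * _ = _
        rw [valueAtRisk_uniformOn x i ht]]
    have hlen : ((i : ℝ) + 1) / n - (i : ℝ) / n = 1 / n := by ring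
    have hle : (i : ℝ) / n ≤ ((i : ℝ) + 1) / n := by gcongr; linarith
    rw [setIntegral_const, Real.volume_real_Ioo_of_le hle, hlen, smul_eq_mul]
    field_simp
  have h2 : ∀ i : Fin n, IntegrableOn
      ((Ioc ((i : ℝ) / n) (((i : ℝ) + 1) / n)).indicator (fun t => V t * (n * a i))) (Ioo 0 1) :=
    fun i => (hV.mul_const _).indicator measurableSet_Ioc
  calc ∫ t in Ioo (0 : ℝ) 1, V t * stepSpectrum a t
      = ∫ t in Ioo (0 : ℝ) 1, ∑ i : Fin n,
          (Ioc ((i : ℝ) / n) (((i : ℝ) + 1) / n)).indicator (fun t => V t * (n * a i)) t := by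
        congr 1 with t
        rw [stepSpectrum, Finset.mul_sum]
        exact Finset.sum_congr rfl fun i _ => hterm i t
    _ = lEstimator a x := by
        rw [integral_finsetSum _ fun i _ => h2 i, lEstimator, ← Finset.sum_neg_distrib]
        exact Finset.sum_congr rfl fun i _ => h1 i

end Empirical

/-! ### Laws of large numbers, existence of samples and the test variable -/

section Sample

variable {Ω : Type*} [MeasurableSpace Ω] {P : Measure Ω} {X : Ω → ℝ} {S : ℕ → Ω → ℝ}

/-- The strong law of large numbers for a function of the sample. -/
lemma IsIIDSample.ae_tendsto_average (hS : IsIIDSample P X S) {g : ℝ → ℝ} (hg : Measurable g)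
    (hgX : Integrable (fun ω => g (X ω)) P) :
    ∀ᵐ ω ∂P, Tendsto (fun n : ℕ => (∑ i ∈ Finset.range n, g (S i ω)) / n) atTop
      (𝓝 (∫ ω, g (X ω) ∂P)) := by
  have hid : ∀ i, IdentDistrib (fun ω => g (S i ω)) (fun ω => g (X ω)) P P := fun i =>
    (hS.2 i).comp hg
  rw [← (hid 0).integral_eq]
  exact strong_law_ae_real (fun i ω => g (S i ω)) ((hid 0).integrable_iff.2 hgX)
    (fun i j hij => (hS.1.indepFun hij).comp hg hg) fun i => (hid i).trans (hid 0).symm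

/-- Almost surely, the values at risk of the empirical distributions converge in `L¹(0, 1)`. -/
lemma IsIIDSample.ae_tendsto_integral_abs_sub [IsProbabilityMeasure P] (hS : IsIIDSample P X S)
    (hX : Integrable X P) :
    ∀ᵐ ω ∂P, Tendsto (fun n : ℕ => ∫ t in Ioo (0 : ℝ) 1,
      |valueAtRisk (uniformOn (univ : Set (Fin (n + 2)))) t (fun i => S i ω) - valueAtRisk P t X|)
      atTop (𝓝 0) := by
  have hmeas : ∀ q : ℚ, MeasurableSet {x : ℝ | x + q < 0} := fun q =>
    measurableSet_lt (measurable_id.add_const _) measurable_const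
  have hnull : ∀ q : ℚ, NullMeasurableSet {ω | X ω + q < 0} P := fun q =>
    nullMeasurableSet_lt (hX.aemeasurable.add_const _) aemeasurable_const
  have hind : ∀ q : ℚ, (fun ω => {x : ℝ | x + q < 0}.indicator (1 : ℝ → ℝ) (X ω)) =
      {ω | X ω + q < 0}.indicator 1 := fun q => rfl
  -- Restricting to rational `q` leaves only countably many null sets to discard.
  have h1 : ∀ᵐ ω ∂P, ∀ q : ℚ, Tendsto (fun n : ℕ =>
      (∑ i ∈ Finset.range n, {x : ℝ | x + q < 0}.indicator (1 : ℝ → ℝ) (S i ω)) / n) atTop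
      (𝓝 (P.real {ω | X ω + q < 0})) := by
    refine ae_all_iff.2 fun q => ?_
    have h := hS.ae_tendsto_average (g := {x : ℝ | x + q < 0}.indicator 1)
      (measurable_one.indicator (hmeas q))
      (by rw [hind]; exact (integrable_const (1 : ℝ)).indicator₀ (hnull q))
    have hv : ∫ ω in {ω | X ω + q < 0}, (1 : Ω → ℝ) ω ∂P = P.real {ω | X ω + q < 0} := by simp
    rwa [hind, integral_indicator₀ (hnull q), hv] at h
  have h2 := hS.ae_tendsto_average measurable_norm hX.norm
  filter_upwards [h1, h2] with ω hω1 hω2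
  refine tendsto_integral_abs_valueAtRisk_sub hX (fun n => integrable_uniformOn_univ_fin _)
    (fun q => ((tendsto_add_atTop_iff_nat 2).2 (hω1 q)).congr fun n => ?_)
    (((tendsto_add_atTop_iff_nat 2).2 hω2).congr fun n => ?_)
  · classical
    rw [uniformOn_univ_fin_real, Finset.sum_range]
    rfl
  · rw [integral_uniformOn_univ_fin, Finset.sum_range]
    rfl

/-- On a space with a uniform random variable, every law on `ℝ` admits an i.i.d. sample. -/
lemma exists_isIIDSample [IsProbabilityMeasure P] {U : Ω → ℝ}
    (hU : HasLaw U (volume.restrict (Icc (0 : ℝ) 1)) P) (hX : AEMeasurable X P) :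
    ∃ S, IsIIDSample P X S := by
  have : IsProbabilityMeasure (P.map X) := Measure.isProbabilityMeasure_map hX
  -- The whole sequence comes from a single uniform variable: the infinite product law on `ℕ → ℝ` is
  -- an image of Lebesgue measure on the unit interval.
  obtain ⟨f, hf, hfmap⟩ := (Measure.infinitePi fun _ : ℕ => P.map X).exists_measurable_map_eq
  set p : ℝ → unitInterval := projIcc 0 1 zero_le_one
  have hp : Measurable p := continuous_projIcc.measurable
  have hpmap : (volume.restrict (Icc (0 : ℝ) 1)).map p = volume := by
    rw [← unitInterval.measurePreserving_coe.map_eq, Measure.map_map hp measurable_subtype_coe]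
    have : p ∘ ((↑) : unitInterval → ℝ) = id := by
      ext x
      simp [p]
    rw [this, Measure.map_id]
  have hZ : AEMeasurable (fun ω => f (p (U ω))) P := (hf.comp hp).comp_aemeasurable hU.aemeasurable
  have hZmap : P.map (fun ω => f (p (U ω))) = Measure.infinitePi fun _ : ℕ => P.map X := by
    rw [← hfmap, ← hpmap, ← hU.map_eq, Measure.map_map hf hp,
      AEMeasurable.map_map_of_aemeasurable (hf.comp hp).aemeasurable hU.aemeasurable]
    rfl
  have hi : ∀ i, P.map (fun ω => f (p (U ω)) i) = P.map X := fun i => by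
    have h := AEMeasurable.map_map_of_aemeasurable
      (measurable_pi_apply (X := fun _ : ℕ => ℝ) i).aemeasurable hZ
    rw [hZmap, Measure.infinitePi_map_eval] at h
    exact h.symm
  refine ⟨fun i ω => f (p (U ω)) i, ?_, fun i => ⟨hZ.eval i, hX, hi i⟩⟩
  rw [iIndepFun_iff_map_fun_eq_infinitePi_map₀ hZ]
  simp only [hi]
  exact hZmap

/-- Integrating a spectrum against this value at risk yields its primitive at `t`. The level `α = t`
already gives `0`, because the constraint in the value at risk is non-strict; hence `Iio`. -/
lemma valueAtRisk_neg_indicator_Iic [IsProbabilityMeasure P] {U : Ω → ℝ}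
    (hU : HasLaw U (volume.restrict (Icc (0 : ℝ) 1)) P) {t : ℝ} (ht : t ∈ Ioo (0 : ℝ) 1)
    {α : ℝ} (hα : α ∈ Ioo (0 : ℝ) 1) :
    valueAtRisk P α (fun ω => -(Iic t).indicator 1 (U ω)) = (Iio t).indicator 1 α := by
  have hX : AEMeasurable (fun ω => -(Iic t).indicator (1 : ℝ → ℝ) (U ω)) P :=
    ((measurable_one.indicator measurableSet_Iic).comp_aemeasurable hU.aemeasurable).neg
  have hUt : P.real {ω | U ω ≤ t} = t := by
    have h := hU.measure_eq (p := (· ≤ t)) measurableSet_Iic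
    have hs : {x | x ≤ t} ∩ Icc (0 : ℝ) 1 = Icc 0 t := by
      ext x
      simp only [mem_inter_iff, mem_ofPred_eq, mem_Icc]
      constructor
      · rintro ⟨h1, h2, -⟩
        exact ⟨h2, h1⟩
      · rintro ⟨h1, h2⟩
        exact ⟨h2, h1, h2.trans ht.2.le⟩
    rw [Measure.restrict_apply' measurableSet_Icc, hs, Real.volume_Icc, sub_zero] at h
    rw [measureReal_def, h, ENNReal.toReal_ofReal ht.1.le]
  refine eq_of_forall_ge_iff fun m => ?_
  rw [valueAtRisk_le_iff hX hα]
  have hset : {ω | -(Iic t).indicator (1 : ℝ → ℝ) (U ω) + m < 0} =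
      if m < 0 then univ else if m < 1 then {ω | U ω ≤ t} else ∅ := by
    ext ω
    by_cases h : U ω ≤ t <;> split_ifs <;> simp [h] <;> linarith
  rw [hset]
  by_cases hαt : α < t
  · rw [indicator_of_mem (mem_Iio.2 hαt)]
    split_ifs with h1 h2
    · simp only [probReal_univ, Pi.one_apply]
      exact iff_of_false (not_le.2 hα.2) (by linarith)
    · rw [hUt]
      exact iff_of_false (not_le.2 hαt) (not_le.2 h2)
    · simpa [hα.1.le] using h2
  · rw [indicator_of_notMem (by simpa using hαt)]
    split_ifs with h1 h2
    · simp only [probReal_univ]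
      exact iff_of_false (not_le.2 hα.2) (not_le.2 h1)
    · rw [hUt]
      exact iff_of_true (not_lt.1 hαt) (not_lt.1 h1)
    · simpa [hα.1.le] using not_lt.1 h1

end Sample

/-! ### Reduction to weak convergence of the spectra, and the equivalence -/

section Consistency

variable {Ω : Type*} [MeasurableSpace Ω] {P : Measure Ω} [IsProbabilityMeasure P] {X : Ω → ℝ}

lemma integrableOn_valueAtRisk_mul (hX : Integrable X P) {f : ℝ → ℝ} {C : ℝ}
    (hf : AEStronglyMeasurable f (volume.restrict (Ioo 0 1)))
    (hC : ∀ t ∈ Ioo (0 : ℝ) 1, |f t| ≤ C) :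
    IntegrableOn (fun t => valueAtRisk P t X * f t) (Ioo 0 1) :=
  (integrableOn_valueAtRisk hX).mul_bdd hf
    ((ae_restrict_mem measurableSet_Ioo).mono fun t ht => hC t ht)

/-- For a sequence of `L`-estimators with bounded step functions, only the weak limit of the step
functions matters. -/
lemma IsIIDSample.ae_tendsto_lEstimator_sub (hX : Integrable X P) {S : ℕ → Ω → ℝ}
    (hS : IsIIDSample P X S) {b : (n : ℕ) → Fin (n + 2) → ℝ} {C : ℝ}
    (hC : ∀ n, ∀ t ∈ Ioo (0 : ℝ) 1, |stepSpectrum (b n) t| ≤ C) :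
    ∀ᵐ ω ∂P, Tendsto (fun n : ℕ => lEstimator (b n) (fun i => S i ω) -
      ∫ t in Ioo (0 : ℝ) 1, valueAtRisk P t X * stepSpectrum (b n) t) atTop (𝓝 0) := by
  filter_upwards [hS.ae_tendsto_integral_abs_sub hX] with ω hω
  refine squeeze_zero_norm (fun n => ?_) (by simpa using hω.const_mul C)
  have hV := integrableOn_valueAtRisk
    (integrable_uniformOn_univ_fin fun i : Fin (n + 2) => S i ω)
  have hm := (measurable_stepSpectrum (b n)).aestronglyMeasurable
    (μ := volume.restrict (Ioo (0 : ℝ) 1))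
  rw [← integral_valueAtRisk_uniformOn_mul_stepSpectrum, ← integral_sub
    (integrableOn_valueAtRisk_mul (integrable_uniformOn_univ_fin _) hm (hC n))
    (integrableOn_valueAtRisk_mul hX hm (hC n)), ← integral_const_mul]
  -- The difference is at most `C` times the `L¹` distance between the empirical and true values at
  -- risk.
  refine norm_integral_le_of_norm_le
    ((hV.sub (integrableOn_valueAtRisk hX)).abs.const_mul C) ?_
  filter_upwards [ae_restrict_mem measurableSet_Ioo] with t ht
  rw [← sub_mul, norm_mul, mul_comm]
  exact mul_le_mul_of_nonneg_right (hC n t ht) (norm_nonneg _)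

/-- If the primitives of the step functions converge to the primitive of the spectrum, then the
step functions converge weakly to the spectrum. -/
lemma tendsto_integral_valueAtRisk_mul (hX : Integrable X P) {φ : ℝ → ℝ}
    (hφ : AntitoneOn φ (Ioo 0 1)) (hφi : IntervalIntegrable φ volume 0 1)
    {f : ℕ → ℝ → ℝ} {C : ℝ} (hf : ∀ n, AntitoneOn (f n) (Ioo 0 1))
    (hfm : ∀ n, Measurable (f n)) (hfi : ∀ n, IntervalIntegrable (f n) volume 0 1)
    (hC : ∀ n, ∀ t ∈ Ioo (0 : ℝ) 1, |f n t| ≤ C)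
    (h : ∀ t ∈ Ioo (0 : ℝ) 1,
      Tendsto (fun n => ∫ s in (0 : ℝ)..t, f n s) atTop (𝓝 (∫ s in (0 : ℝ)..t, φ s))) :
    Tendsto (fun n => ∫ t in Ioo (0 : ℝ) 1, valueAtRisk P t X * f n t) atTop
      (𝓝 (∫ t in Ioo (0 : ℝ) 1, valueAtRisk P t X * φ t)) := by
  refine tendsto_integral_of_dominated_convergence (fun t => |valueAtRisk P t X| * C)
    (fun n => (integrableOn_valueAtRisk_mul hX (hfm n).aestronglyMeasurable
      (hC n)).aestronglyMeasurable)
    ((integrableOn_valueAtRisk hX).abs.mul_const C) (fun n => ?_) ?_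
  · filter_upwards [ae_restrict_mem measurableSet_Ioo] with t ht
    rw [norm_mul]
    exact mul_le_mul_of_nonneg_left (hC n t ht) (norm_nonneg _)
  · filter_upwards [hφ.ae_continuousAt_Ioo] with t ht
    exact (tendsto_of_tendsto_integral_of_antitoneOn hf hφ hfi hφi h ht.1 ht.2).const_mul _

end Consistency

theorem mainTheorem4 {Ω : Type*} [MeasurableSpace Ω] (P : Measure Ω) [IsProbabilityMeasure P]
    (hΩ : ∃ U : Ω → ℝ, HasLaw U (volume.restrict (Icc (0 : ℝ) 1)) P)
    (φ : ℝ → ℝ) (hφ : IsRiskSpectrum φ)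
    (a : (n : ℕ) → Fin n → ℝ)
    (ha : ∀ n, 1 < n → a n ∈ stdSimplex ℝ (Fin n))
    (ha_anti : ∀ n, 1 < n → Antitone (a n))
    (hbdd : ∃ C : ℝ, ∀ n, 1 < n → ∀ t ∈ Icc (0 : ℝ) 1, stepSpectrum (a n) t ≤ C) :
    (∀ X : Ω → ℝ, Integrable X P →
      IntervalIntegrable (fun α => valueAtRisk P α X * φ α) volume 0 1) ∧
    (IsConsistent P {X | Integrable X P} (fun n => lEstimator (a n))
        (fun X => (spectralRiskMeasure P φ X : WithTop ℝ)) ↔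
      ∀ t ∈ Ioo (0 : ℝ) 1,
        Tendsto (fun n : ℕ => ∫ s in (0 : ℝ)..t, stepSpectrum (a n) s) atTop
          (𝓝 (∫ s in (0 : ℝ)..t, φ s))) := by
  obtain ⟨C, hC⟩ := hbdd
  obtain ⟨D, hD⟩ := hφ.bounded
  -- Sample sizes are shifted to `n + 2`, since the hypotheses concern only sizes above `1` and
  -- limits ignore finitely many terms.
  have hCb : ∀ n, ∀ t ∈ Ioo (0 : ℝ) 1, |stepSpectrum (a (n + 2)) t| ≤ C := fun n t ht => by
    rw [abs_of_nonneg (stepSpectrum_nonneg (ha (n + 2) (by omega)).1 t)]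
    exact hC (n + 2) (by omega) t (Ioo_subset_Icc_self ht)
  have hDb : ∀ t ∈ Ioo (0 : ℝ) 1, |φ t| ≤ D := fun t ht => by
    rw [abs_of_nonneg (hφ.nonneg t (Ioo_subset_Icc_self ht))]
    exact hD t (Ioo_subset_Icc_self ht)
  have hφanti : AntitoneOn φ (Ioo 0 1) := hφ.antitoneOn.mono Ioo_subset_Icc_self
  have hφm : AEStronglyMeasurable φ (volume.restrict (Ioo 0 1)) :=
    (aemeasurable_restrict_of_antitoneOn measurableSet_Ioo hφanti).aestronglyMeasurable
  have hφi : IntervalIntegrable φ volume 0 1 :=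
    AntitoneOn.intervalIntegrable (by rw [uIcc_of_le zero_le_one]; exact hφ.antitoneOn)
  have hsi : ∀ n, IntervalIntegrable (stepSpectrum (a (n + 2))) volume 0 1 := fun n => by
    rw [intervalIntegrable_iff_integrableOn_Ioo_of_le zero_le_one]
    exact Measure.integrableOn_of_bounded (M := C) (by simp)
      (measurable_stepSpectrum _).aestronglyMeasurable
      ((ae_restrict_mem measurableSet_Ioo).mono fun t ht => hCb n t ht)
  have hρ : ∀ X, spectralRiskMeasure P φ X = ∫ t in Ioo (0 : ℝ) 1, valueAtRisk P t X * φ t :=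
    fun X => by
      rw [spectralRiskMeasure, intervalIntegral.integral_of_le zero_le_one,
        integral_Ioc_eq_integral_Ioo]
  refine ⟨fun X hX => ?_, fun hcons t ht => ?_, fun hlim X hX r hr S hS => ?_⟩
  · rw [intervalIntegrable_iff_integrableOn_Ioo_of_le zero_le_one]
    exact integrableOn_valueAtRisk_mul hX hφm hDb
  · obtain ⟨U, hU⟩ := hΩ
    set X : Ω → ℝ := fun ω => -(Iic t).indicator 1 (U ω) with hXdef
    have hXm : AEMeasurable X P :=
      ((measurable_one.indicator measurableSet_Iic).comp_aemeasurable hU.aemeasurable).neg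
    have hX : Integrable X P := by
      refine Integrable.of_bound hXm.aestronglyMeasurable 1 (Eventually.of_forall fun ω => ?_)
      by_cases h : U ω ≤ t <;> simp [hXdef, h]
    obtain ⟨S, hS⟩ := exists_isIIDSample hU hXm
    have hint : ∀ f : ℝ → ℝ, ∫ α in Ioo (0 : ℝ) 1, valueAtRisk P α X * f α =
        ∫ s in (0 : ℝ)..t, f s := by
      intro f
      have hcongr : ∀ α ∈ Ioo (0 : ℝ) 1, valueAtRisk P α X * f α = (Iio t).indicator f α := by
        intro α hα
        rw [valueAtRisk_neg_indicator_Iic hU ht hα]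
        by_cases h : α < t <;> simp [h]
      rw [setIntegral_congr_fun measurableSet_Ioo hcongr, setIntegral_indicator measurableSet_Iio,
        intervalIntegral.integral_of_le ht.1.le, integral_Ioc_eq_integral_Ioo, Ioo_inter_Iio,
        min_eq_right ht.2.le]
    -- The desired limit is deterministic, so one sample point at which both almost sure limits hold
    -- suffices.
    obtain ⟨ω, h1, h2⟩ := ((hcons X hX _ rfl S hS).and
      (hS.ae_tendsto_lEstimator_sub hX hCb)).exists
    rw [← tendsto_add_atTop_iff_nat 2] at h1 ⊢
    rw [hρ] at h1
    simp only [hint] at h1 h2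
    simpa using h1.sub h2
  · obtain rfl : spectralRiskMeasure P φ X = r := WithTop.coe_injective hr
    have hweak := tendsto_integral_valueAtRisk_mul hX hφanti hφi
      (fun n => (antitoneOn_stepSpectrum (ha_anti (n + 2) (by omega))).mono Ioo_subset_Ioc_self)
      (fun n => measurable_stepSpectrum _) hsi hCb
      fun t ht => (tendsto_add_atTop_iff_nat 2).2 (hlim t ht)
    filter_upwards [hS.ae_tendsto_lEstimator_sub hX hCb] with ω hω
    rw [← tendsto_add_atTop_iff_nat 2, hρ]
    simpa using hω.add hweak
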